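/- **Theorem (Eigenvalue Exclusion Theorem).** Let $\mathbb F$ be a field, let $k\ge 1$, and let $\{\phi_0,\dots,\phi_k\}\subset\mathbb F[\lambda]$ be a polynomial basis, that is, a basis of the polynomials of degree at most $k$ such that $\phi_0,\dots,\phi_{k-1}$ is a basis of the polynomials of degree at most $k-1$ (for example any degree-graded basis). Let $P(\lambda)=\sum_{i=0}^k P_i\phi_i(\lambda)$ with $P_i\in\mathbb F^{n\times n}$ and $P_k\neq 0$ be an $n\times n$ matrix polynomial of degree $k$, and assume that $P$ is regular, i.e. $\det P(\lambda)\not\equiv 0$. Put $\Lambda(\lambda)=[\phi_{k-1}(\lambda),\dots,\phi_0(\lambda)]^T$. Let $L(\lambda)=\lambda X+Y$ with $X,Y\in\mathbb F^{nk\times nk}$ belong to the double ansatz space $\mathbb{DL}(P)$ with ansatz vector $v=[v_{k-1},\dots,v_0]^T\in\mathbb F^k$; that is, $$L(\lambda)\,(\Lambda(\lambda)\otimes I_n)=v\otimes P(\lambda)\quad\text{and}\quad(\Lambda(\lambda)^T\otimes I_n)\,L(\lambda)=w^T\otimes P(\lambda)\ \text{ for some } w\in\mathbb F^k.$$ Assume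 that the ansatz polynomial $v(\lambda)=\sum_{i=0}^{k-1}v_i\phi_i(\lambda)$ is nonzero. Then $L$ is a linearization for $P$, i.e. there are matrix polynomials $U(\lambda),V(\lambda)$ over $\mathbb F$ whose determinants are nonzero elements of $\mathbb F$ such that $L(\lambda)=U(\lambda)\,\mathrm{diag}(P(\lambda),I_{n(k-1)})\,V(\lambda)$, if and only if $P(\lambda)$, taken with grade $k$, and $v(\lambda)I_n$, taken with grade $k-1$, have no common eigenvalue in $\overline{\mathbb F}\cup\{\infty\}$. Here $\overline{\mathbb F}$ is an algebraic closure of $\mathbb F$. For a regular matrix polynomial $Q(\lambda)$ taken with grade $g$ (all entries have degree at most $g$), $\mu\in\overline{\mathbb F}$ is an eigenvalue if $\det Q(\mu)=0$, and $\infty$ is an eigenvalue if the coefficient matrix of $\lambda^g$ in $Q(\lambda)$, which may be zero, is singular. -/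

import Mathlib

open Polynomial Matrix
open scoped Kronecker

namespace MatPoly

variable {F : Type*} [Field F] {n k : ℕ}

/-- `φ 0, …, φ k` is a polynomial basis: the `φ i` are a basis of the polynomials of degree at
most `k`, and `φ 0, …, φ (k-1)` span the polynomials of degree at most `k - 1`, so that
`[φ (k-1), …, φ 0]` and `[λ ^ (k-1), …, λ, 1]` are related by an invertible change of basis.
Degree-graded bases are special cases; no `φ i` with `i < k` is required to have degree `i`. -/
structure IsPolynomialBasis (φ : Fin (k + 1) → F[X]) : Prop where
  linearIndependent : LinearIndependent F φ
  span_eq : Submodule.span F (Set.range φ) = degreeLT F (k + 1)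
  span_init_eq : Submodule.span F (Set.range fun i : Fin k => φ i.castSucc) = degreeLT F k

/-- The matrix polynomial `∑ i, A i * φ i` with coefficients `A i` in the basis `φ`. -/
noncomputable def ofCoeffs (φ : Fin (k + 1) → F[X])
    (A : Fin (k + 1) → Matrix (Fin n) (Fin n) F) : Matrix (Fin n) (Fin n) F[X] :=
  ∑ i, φ i • (A i).map C

/-- A square matrix polynomial is regular if its determinant is not the zero polynomial. -/
def IsRegular (P : Matrix (Fin n) (Fin n) F[X]) : Prop :=
  P.det ≠ 0

/-- The vector `Λ = [φ (k-1), …, φ 1, φ 0]`. -/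
def basisVec (φ : Fin (k + 1) → F[X]) : Fin k → F[X] :=
  fun j => φ j.rev.castSucc

/-- The pencil `λ X + Y`. Its rows and columns are indexed by pairs `(block, index in block)`. -/
noncomputable def pencil (X Y : Matrix (Fin k × Fin n) (Fin k × Fin n) F) :
    Matrix (Fin k × Fin n) (Fin k × Fin n) F[X] :=
  (Polynomial.X : F[X]) • X.map C + Y.map C

/-- The condition `L(λ) (Λ(λ) ⊗ I) = v ⊗ P(λ)`. -/
def HasAnsatz (φ : Fin (k + 1) → F[X]) (P : Matrix (Fin n) (Fin n) F[X])
    (L : Matrix (Fin k × Fin n) (Fin k × Fin n) F[X]) (v : Fin k → F) : Prop :=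
  L * (replicateCol Unit (basisVec φ) ⊗ₖ (1 : Matrix (Fin n) (Fin n) F[X])) =
    replicateCol Unit (fun i => C (v i)) ⊗ₖ P

/-- The condition `(Λ(λ)ᵀ ⊗ I) L(λ) = wᵀ ⊗ P(λ)`. -/
def HasLeftAnsatz (φ : Fin (k + 1) → F[X]) (P : Matrix (Fin n) (Fin n) F[X])
    (L : Matrix (Fin k × Fin n) (Fin k × Fin n) F[X]) (w : Fin k → F) : Prop :=
  (replicateRow Unit (basisVec φ) ⊗ₖ (1 : Matrix (Fin n) (Fin n) F[X])) * L =
    replicateRow Unit (fun i => C (w i)) ⊗ₖ P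

/-- The space `𝕃₁(P)`. -/
def L1 (φ : Fin (k + 1) → F[X]) (P : Matrix (Fin n) (Fin n) F[X]) :
    Set (Matrix (Fin k × Fin n) (Fin k × Fin n) F[X]) :=
  {L | (∃ X Y, L = pencil X Y) ∧ ∃ v, HasAnsatz φ P L v}

/-- The space `𝕃₂(P)`. -/
def L2 (φ : Fin (k + 1) → F[X]) (P : Matrix (Fin n) (Fin n) F[X]) :
    Set (Matrix (Fin k × Fin n) (Fin k × Fin n) F[X]) :=
  {L | (∃ X Y, L = pencil X Y) ∧ ∃ w, HasLeftAnsatz φ P L w}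

/-- The double ansatz space `𝔻𝕃(P) = 𝕃₁(P) ∩ 𝕃₂(P)`. -/
def DL (φ : Fin (k + 1) → F[X]) (P : Matrix (Fin n) (Fin n) F[X]) :
    Set (Matrix (Fin k × Fin n) (Fin k × Fin n) F[X]) :=
  L1 φ P ∩ L2 φ P

/-- The ansatz polynomial `v(λ) = ∑ i, v_i φ_i(λ)` of the vector `v = [v_{k-1}, …, v_0]`. -/
noncomputable def ansatzPoly (φ : Fin (k + 1) → F[X]) (v : Fin k → F) : F[X] :=
  ∑ j, C (v j) * basisVec φ j

/-- The determinant is a nonzero element of `F`. -/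
def IsUnimodular (U : Matrix (Fin k × Fin n) (Fin k × Fin n) F[X]) : Prop :=
  ∃ c : F, c ≠ 0 ∧ U.det = C c

/-- The matrix `diag(P, I_{n(k-1)})`: the first of the `k` diagonal blocks is `P`, the others
are `I_n`. -/
noncomputable def diagOne (k : ℕ) (P : Matrix (Fin n) (Fin n) F[X]) :
    Matrix (Fin k × Fin n) (Fin k × Fin n) F[X] :=
  (blockDiagonal fun i : Fin k => if (i : ℕ) = 0 then P else 1).submatrix Prod.swap Prod.swap

/-- `L` is a linearization of `P` if `L = U diag(P, I_{n(k-1)}) V` with `U`, `V` unimodular. -/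
def IsLinearization (L : Matrix (Fin k × Fin n) (Fin k × Fin n) F[X])
    (P : Matrix (Fin n) (Fin n) F[X]) : Prop :=
  ∃ U V, IsUnimodular U ∧ IsUnimodular V ∧ L = U * diagOne k P * V

/-- Eigenvalues, in the algebraic closure of `F` together with `∞`, of a regular matrix
polynomial `Q` of grade `g` (all entries of degree at most `g`). The finite ones are the points
where `Q` is singular; `∞` is one if the coefficient of `λ ^ g` is singular. -/
def IsEigenvalue (g : ℕ) (Q : Matrix (Fin n) (Fin n) F[X]) :
    OnePoint (AlgebraicClosure F) → Prop
  | OnePoint.infty => (Q.map fun p => p.coeff g).det = 0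
  | OnePoint.some μ => (Q.map fun p => aeval μ p).det = 0

end MatPoly

/-! Passing to the monomial basis is a constant congruence of `L`, so only monomials matter. There
both ansatz vectors agree, since `P ≠ 0`, and comparing coefficients gives the block relations
`IsDoubleAnsatz`. With m = k - 1, let W be the constant matrix [v ⊗ I, X_0, …, X_{m-1}]
(`ansatzBlock`), where X_j is a block column. The right relations alone yield L = W · H · diag(P, I)
· S with H and S unimodular (`IsDoubleAnsatz.pencil_eq`). As `P` is regular, determinants show that
L is a linearization iff det W ≠ 0.

Singularity of W means that X and v ⊗ I have a nonzero common left null space, which may be tested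
over the algebraic closure. Unless v and P share the eigenvalue ∞, some shift u ↦ (u_1, …, u_m,
e(u)) preserves this space (`IsDoubleAnsatz.exists_common_eigenvalue`). An eigenvector of the shift
is (z, μz, …, μ^m z) with z ≠ 0, which forces v(μ) = 0 and zP(μ) = 0. Conversely, a common
eigenvalue puts such a vector, or (0, …, 0, z) for ∞, into the null space. -/

namespace MatPoly

/-! ### Block relations of a double ansatz pencil -/

section Blocks

variable {R S ι : Type*} [CommRing R] [CommRing S] {m : ℕ}

/-- The relations between the blocks `X i j`, `Y i j` of a pencil in the double ansatz space of
`∑ i ≤ m + 1, P i * λ ^ i`, relative to the monomials `1, λ, …, λ ^ m`. -/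
structure IsDoubleAnsatz (X Y : Fin (m + 1) → Fin (m + 1) → Matrix ι ι R)
    (v : Fin (m + 1) → R) (P : ℕ → Matrix ι ι R) : Prop where
  right_zero : ∀ i, Y i 0 = v i • P 0
  right_succ : ∀ i (j : Fin m), X i j.castSucc + Y i j.succ = v i • P (j + 1)
  right_last : ∀ i, X i (Fin.last m) = v i • P (m + 1)
  left_zero : ∀ j, Y 0 j = v j • P 0
  left_succ : ∀ (i : Fin m) j, X i.castSucc j + Y i.succ j = v j • P (i + 1)
  left_last : ∀ j, X (Fin.last m) j = v j • P (m + 1)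

theorem IsDoubleAnsatz.map {X Y : Fin (m + 1) → Fin (m + 1) → Matrix ι ι R}
    {v : Fin (m + 1) → R} {P : ℕ → Matrix ι ι R} (h : IsDoubleAnsatz X Y v P) (f : R →+* S) :
    IsDoubleAnsatz (fun i j => (X i j).map f) (fun i j => (Y i j).map f) (fun i => f (v i))
      (fun i => (P i).map f) := by
  have hs : ∀ (c : R) (M : Matrix ι ι R), (c • M).map f = f c • M.map f := by
    intro c M; ext; simp
  have ha : ∀ M N : Matrix ι ι R, (M + N).map f = M.map f + N.map f := by
    intro M N; ext; simp
  constructor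
  · intro i; rw [h.right_zero, hs]
  · intro i j; rw [← ha, h.right_succ, hs]
  · intro i; rw [h.right_last, hs]
  · intro i; rw [h.left_zero, hs]
  · intro i j; rw [← ha, h.left_succ, hs]
  · intro i; rw [h.left_last, hs]

end Blocks

/-! ### The common left null space and its shift -/

section Kernel

variable {K ι : Type*} [Field K] [Fintype ι] {m : ℕ}

/-- The common left kernel of the block columns of `X` and of `v ⊗ I`. -/
def leftKernel (X : Fin (m + 1) → Fin (m + 1) → Matrix ι ι K) (v : Fin (m + 1) → K) :
    Submodule K (Fin (m + 1) → ι → K) where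
  carrier := {u | (∀ j, ∑ i, u i ᵥ* X i j = 0) ∧ ∑ i, v i • u i = 0}
  add_mem' := by
    rintro a b ⟨ha, ha'⟩ ⟨hb, hb'⟩
    refine ⟨fun j => ?_, ?_⟩
    · simp only [Pi.add_apply, add_vecMul, Finset.sum_add_distrib, ha, hb, add_zero]
    · simp only [Pi.add_apply, smul_add, Finset.sum_add_distrib, ha', hb', add_zero]
  zero_mem' := by simp
  smul_mem' := by
    rintro c a ⟨ha, ha'⟩
    refine ⟨fun j => ?_, ?_⟩
    · simp only [Pi.smul_apply, smul_vecMul, ← Finset.smul_sum, ha, smul_zero]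
    · simp only [Pi.smul_apply, smul_comm _ c, ← Finset.smul_sum, ha', smul_zero]

variable {X Y : Fin (m + 1) → Fin (m + 1) → Matrix ι ι K} {v : Fin (m + 1) → K}
  {P : ℕ → Matrix ι ι K}

/-- By the right relations, each block column of Y is v ⊗ P_j minus a block column of X, and u kills
both. -/
theorem IsDoubleAnsatz.sum_vecMul_Y (h : IsDoubleAnsatz X Y v P) {u : Fin (m + 1) → ι → K}
    (hu : u ∈ leftKernel X v) (j : Fin (m + 1)) : ∑ i, u i ᵥ* Y i j = 0 := by
  have hv : ∀ M : Matrix ι ι K, ∑ i, u i ᵥ* (v i • M) = 0 := by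
    intro M
    have : ∀ i, u i ᵥ* (v i • M) = (v i • u i) ᵥ* M := fun i => by
      rw [vecMul_smul, smul_vecMul]
    simp only [this, ← sum_vecMul]
    rw [hu.2, zero_vecMul]
  refine Fin.cases ?_ (fun j => ?_) j
  · simp only [h.right_zero, hv]
  · have := hv (P (j + 1))
    simp only [← h.right_succ, vecMul_add, Finset.sum_add_distrib] at this
    rwa [hu.1, zero_add] at this

/-- The left relations replace X_{i,j} by v_j P_{i+1} - Y_{i+1,j}. Since u kills Y, the Y terms add
up to u_0 Y_{0,j} = v_j u_0 P_0. The obstruction to staying in the null space of X is thus one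
vector, independent of j. -/
theorem IsDoubleAnsatz.sum_snoc_vecMul (h : IsDoubleAnsatz X Y v P)
    {u : Fin (m + 1) → ι → K} (hu : u ∈ leftKernel X v) (e : ι → K) (j : Fin (m + 1)) :
    ∑ i, (Fin.snoc (Fin.tail u) e : Fin (m + 1) → ι → K) i ᵥ* X i j =
      v j • (∑ i, u i ᵥ* P i + e ᵥ* P (m + 1)) := by
  have hY := h.sum_vecMul_Y hu j
  rw [Fin.sum_univ_succ, h.left_zero] at hY
  have h1 : ∀ i : Fin m, u i.succ ᵥ* X i.castSucc j =
      v j • u i.succ ᵥ* P (i + 1) - u i.succ ᵥ* Y i.succ j := by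
    intro i
    rw [eq_sub_iff_add_eq, ← vecMul_add, h.left_succ, vecMul_smul]
  rw [Fin.sum_univ_castSucc]
  simp only [Fin.snoc_castSucc, Fin.snoc_last, Fin.tail, h.left_last, h1,
    Finset.sum_sub_distrib, ← Finset.smul_sum, eq_neg_of_add_eq_zero_right hY, vecMul_smul]
  rw [Fin.sum_univ_succ]
  simp only [Fin.val_zero, Fin.val_succ, smul_add]
  abel

/-- The linear map sending `u 0, …, u m` to `u 1, …, u m, e u`. -/
def shiftMap (e : (Fin (m + 1) → ι → K) →ₗ[K] (ι → K)) : Module.End K (Fin (m + 1) → ι → K) where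
  toFun u := (Fin.snoc (Fin.tail u) (e u) : Fin (m + 1) → ι → K)
  map_add' a b := by
    ext i : 1
    refine Fin.lastCases ?_ (fun i => ?_) i <;> simp [Fin.tail]
  map_smul' c a := by
    ext i : 1
    refine Fin.lastCases ?_ (fun i => ?_) i <;> simp [Fin.tail]

omit [Fintype ι] in
theorem shiftMap_apply (e : (Fin (m + 1) → ι → K) →ₗ[K] (ι → K)) (u : Fin (m + 1) → ι → K) :
    shiftMap e u = (Fin.snoc (Fin.tail u) (e u) : Fin (m + 1) → ι → K) := rfl

/-- If the left kernel is stable under a shift, an eigenvector of the shift yields a common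
eigenvalue of `v` and `P`. -/
theorem IsDoubleAnsatz.exists_root_of_shift [DecidableEq ι] [IsAlgClosed K] (h : IsDoubleAnsatz X Y v P)
    (hS : leftKernel X v ≠ ⊥) (e : (Fin (m + 1) → ι → K) →ₗ[K] (ι → K))
    (hP : ∀ u ∈ leftKernel X v, ∑ i, u i ᵥ* P i + e u ᵥ* P (m + 1) = 0)
    (hv : ∀ u ∈ leftKernel X v, ∑ i, v i • shiftMap e u i = 0) :
    ∃ μ : K, ∑ i, v i * μ ^ (i : ℕ) = 0 ∧
      (∑ i ∈ Finset.range (m + 2), μ ^ i • P i).det = 0 := by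
  have hT : ∀ u ∈ leftKernel X v, shiftMap e u ∈ leftKernel X v := fun u hu =>
    ⟨fun j => by
      rw [shiftMap_apply, h.sum_snoc_vecMul hu, hP u hu, smul_zero], hv u hu⟩
  have : Nontrivial (leftKernel X v) := Submodule.nontrivial_iff_ne_bot.2 hS
  obtain ⟨μ, hμ⟩ := Module.End.exists_eigenvalue ((shiftMap e).restrict hT)
  obtain ⟨⟨u, hu⟩, hev⟩ := hμ.exists_hasEigenvector
  have hne : u ≠ 0 := fun h0 => hev.2 (Subtype.ext h0)
  have heq : shiftMap e u = μ • u := congrArg Subtype.val hev.apply_eq_smul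
  have hsucc : ∀ i : Fin m, u i.succ = μ • u i.castSucc := fun i => by
    have := congrFun heq i.castSucc
    rwa [shiftMap_apply, Fin.snoc_castSucc] at this
  have hlast : e u = μ • u (Fin.last m) := by
    have := congrFun heq (Fin.last m)
    rwa [shiftMap_apply, Fin.snoc_last] at this
  have hpow : ∀ i : Fin (m + 1), u i = μ ^ (i : ℕ) • u 0 := by
    intro i
    induction i using Fin.induction with
    | zero => simp
    | succ i ih => rw [hsucc, ih, smul_smul, Fin.val_succ, pow_succ', Fin.val_castSucc]
  have hu0 : u 0 ≠ 0 := fun h0 => hne (by ext1 i; rw [hpow i, h0, smul_zero]; rfl)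
  refine ⟨μ, ?_, ?_⟩
  · have h2 := hu.2
    have : ∀ i, v i • u i = (v i * μ ^ (i : ℕ)) • u 0 := fun i => by rw [mul_smul, ← hpow]
    simp only [this, ← Finset.sum_smul] at h2
    exact (smul_eq_zero.1 h2).resolve_right hu0
  · rw [← exists_vecMul_eq_zero_iff]
    refine ⟨u 0, hu0, ?_⟩
    have h2 := hP u hu
    -- The appended entry is μ^{m+1} u_0 and supplies the top-degree term of u_0 P(μ).
    rw [hlast, hpow (Fin.last m), smul_smul, Fin.val_last, ← pow_succ'] at h2
    rw [vecMul_sum, Finset.sum_range_succ, Finset.sum_range]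
    simp only [vecMul_smul]
    rw [← h2, smul_vecMul]
    congr 1
    refine Finset.sum_congr rfl fun i _ => ?_
    conv_rhs => rw [hpow i, smul_vecMul]

/-- The appended entry must meet two conditions, one for X and one for v ⊗ I. Invertibility of
P_{m+1} or of v_m lets one be solved; the last block column v ⊗ P_{m+1} of X then yields the other.
If neither is invertible, ∞ is a common eigenvalue. -/
theorem IsDoubleAnsatz.exists_common_eigenvalue [DecidableEq ι] [IsAlgClosed K] (h : IsDoubleAnsatz X Y v P)
    (hS : leftKernel X v ≠ ⊥) :
    (v (Fin.last m) = 0 ∧ (P (m + 1)).det = 0) ∨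
    ∃ μ : K, ∑ i, v i * μ ^ (i : ℕ) = 0 ∧
      (∑ i ∈ Finset.range (m + 2), μ ^ i • P i).det = 0 := by
  by_cases hv : v (Fin.last m) = 0
  · by_cases hd : (P (m + 1)).det = 0
    · exact Or.inl ⟨hv, hd⟩
    · right
      have hunit : IsUnit (P (m + 1)).det := isUnit_iff_ne_zero.2 hd
      -- The solution of ∑ u_i P_i + e P_{m+1} = 0.
      let e : (Fin (m + 1) → ι → K) →ₗ[K] (ι → K) :=
        -((P (m + 1))⁻¹.vecMulLinear ∘ₗ ∑ i : Fin (m + 1), (P i).vecMulLinear ∘ₗ LinearMap.proj i)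
      have he : ∀ u, e u = -((∑ i, u i ᵥ* P i) ᵥ* (P (m + 1))⁻¹) := by
        intro u
        simp [e, sum_vecMul]
      have hP : ∀ u ∈ leftKernel X v, ∑ i, u i ᵥ* P i + e u ᵥ* P (m + 1) = 0 := by
        intro u _
        rw [he, neg_vecMul, vecMul_vecMul, nonsing_inv_mul _ hunit, vecMul_one, add_neg_cancel]
      refine h.exists_root_of_shift hS e hP fun u hu => ?_
      have h2 := h.sum_snoc_vecMul hu (e u) (Fin.last m)
      rw [hP u hu, smul_zero, ← shiftMap_apply] at h2
      have h3 : ∀ i, shiftMap e u i ᵥ* X i (Fin.last m) =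
          (v i • shiftMap e u i) ᵥ* P (m + 1) := fun i => by
        rw [h.right_last, vecMul_smul, smul_vecMul]
      simp only [h3, ← sum_vecMul] at h2
      by_contra hne
      exact hd (exists_vecMul_eq_zero_iff.1 ⟨_, hne, h2⟩)
  · right
    -- The solution of ∑_{i<m} v_i u_{i+1} + v_m e = 0.
    let e : (Fin (m + 1) → ι → K) →ₗ[K] (ι → K) :=
      -((v (Fin.last m))⁻¹ • ∑ i : Fin m, v i.castSucc • LinearMap.proj i.succ)
    have he : ∀ u, v (Fin.last m) • e u = -∑ i : Fin m, v i.castSucc • u i.succ := by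
      intro u
      simp [e, smul_smul, hv]
    have hV : ∀ u, ∑ i, v i • shiftMap e u i = 0 := by
      intro u
      rw [Fin.sum_univ_castSucc]
      simp only [shiftMap_apply, Fin.snoc_castSucc, Fin.snoc_last, Fin.tail, he]
      exact add_neg_cancel _
    refine h.exists_root_of_shift hS e (fun u hu => ?_) fun u _ => hV u
    have h2 := h.sum_snoc_vecMul hu (e u) (Fin.last m)
    have h3 : ∀ i, shiftMap e u i ᵥ* X i (Fin.last m) =
        (v i • shiftMap e u i) ᵥ* P (m + 1) := fun i => by
      rw [h.right_last, vecMul_smul, smul_vecMul]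
    rw [← shiftMap_apply] at h2
    simp only [h3, ← sum_vecMul] at h2
    rw [hV, zero_vecMul] at h2
    exact (smul_eq_zero.1 h2.symm).resolve_left hv

theorem IsDoubleAnsatz.leftKernel_ne_bot_of_infty [DecidableEq ι] (h : IsDoubleAnsatz X Y v P)
    (hv : v (Fin.last m) = 0) (hP : (P (m + 1)).det = 0) : leftKernel X v ≠ ⊥ := by
  obtain ⟨z, hz, hzP⟩ := exists_vecMul_eq_zero_iff.2 hP
  refine (Submodule.ne_bot_iff _).2 ⟨Pi.single (Fin.last m) z, ⟨fun j => ?_, ?_⟩, ?_⟩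
  · rw [Finset.sum_eq_single_of_mem (Fin.last m) (Finset.mem_univ _)]
    · rw [Pi.single_eq_same, h.left_last, vecMul_smul, hzP, smul_zero]
    · intro i _ hi
      rw [Pi.single_eq_of_ne hi, zero_vecMul]
  · rw [Finset.sum_eq_single_of_mem (Fin.last m) (Finset.mem_univ _)]
    · rw [hv, zero_smul]
    · intro i _ hi
      rw [Pi.single_eq_of_ne hi, smul_zero]
  · exact fun h0 => hz (Pi.single_eq_zero_iff.1 h0)

theorem IsDoubleAnsatz.leftKernel_ne_bot_of_root [DecidableEq ι] (h : IsDoubleAnsatz X Y v P) {μ : K}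
    (hv : ∑ i, v i * μ ^ (i : ℕ) = 0)
    (hP : (∑ i ∈ Finset.range (m + 2), μ ^ i • P i).det = 0) : leftKernel X v ≠ ⊥ := by
  obtain ⟨z, hz, hzP⟩ := exists_vecMul_eq_zero_iff.2 hP
  have hvz : ∀ M : Matrix ι ι K, ∑ i : Fin (m + 1), (μ ^ (i : ℕ) • z) ᵥ* (v i • M) = 0 := by
    intro M
    have : ∀ i : Fin (m + 1), (μ ^ (i : ℕ) • z) ᵥ* (v i • M) =
        (v i * μ ^ (i : ℕ)) • z ᵥ* M := fun i => by
      rw [vecMul_smul, smul_vecMul, smul_smul]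
    simp only [this, ← Finset.sum_smul, hv, zero_smul]
  -- By the left relations, the left side is v_j zP(μ).
  have hXY : ∀ j, μ • (∑ i : Fin (m + 1), (μ ^ (i : ℕ) • z) ᵥ* X i j) +
      ∑ i : Fin (m + 1), (μ ^ (i : ℕ) • z) ᵥ* Y i j = 0 := by
    intro j
    have hk := congrArg (fun x => v j • x) hzP
    simp only [smul_zero, vecMul_sum, vecMul_smul] at hk
    rw [← hk, Fin.sum_univ_castSucc, Fin.sum_univ_succ, Finset.sum_range_succ,
      Finset.sum_range_succ', Finset.sum_range, h.left_zero, h.left_last]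
    have h1 : ∀ i : Fin m, (μ ^ ((i.succ : Fin (m + 1)) : ℕ) • z) ᵥ* Y i.succ j =
        v j • (μ ^ ((i : ℕ) + 1) • z ᵥ* P (i + 1)) -
          μ • (μ ^ ((i.castSucc : Fin (m + 1)) : ℕ) • z) ᵥ* X i.castSucc j := by
      intro i
      rw [eq_sub_iff_add_eq', smul_vecMul, smul_smul, Fin.val_castSucc, ← pow_succ',
        Fin.val_succ, smul_vecMul, ← smul_add, ← vecMul_add, h.left_succ, vecMul_smul,
        smul_comm]
    simp only [h1, Finset.sum_sub_distrib, smul_add, ← Finset.smul_sum, vecMul_smul,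
      smul_vecMul, Fin.val_last, Fin.val_zero, pow_zero, one_smul]
    rw [smul_comm μ (v j), smul_smul μ, ← pow_succ', Finset.smul_sum]
    simp only [← Finset.smul_sum]
    abel
  -- Descend from the last column, which is v ⊗ P_{m+1}: if X_{j+1} is killed, then so is Y_{j+1} by
  -- `hXY`, hence so is X_j = v ⊗ P_{j+1} - Y_{j+1}.
  have hX : ∀ j, ∑ i : Fin (m + 1), (μ ^ (i : ℕ) • z) ᵥ* X i j = 0 := by
    intro j
    induction j using Fin.reverseInduction with
    | last => simp only [h.right_last, hvz]
    | cast j ih =>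
      have h1 := hXY j.succ
      rw [ih, smul_zero, zero_add] at h1
      have h2 := hvz (P (j + 1))
      simp only [← h.right_succ, vecMul_add, Finset.sum_add_distrib] at h2
      rwa [h1, add_zero] at h2
  refine (Submodule.ne_bot_iff _).2 ⟨fun i => μ ^ (i : ℕ) • z, ⟨hX, ?_⟩, fun h0 => hz ?_⟩
  · simp only [smul_smul, ← Finset.sum_smul, hv, zero_smul]
  · simpa using congrFun h0 0

end Kernel

/-! ### The block factors of the pencil -/

section Factorization

variable {R K ι : Type*} [CommRing R] [Field K] [Fintype ι] [DecidableEq ι] {m : ℕ}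

/-- The block matrix `[v ⊗ I, X 0, …, X (m - 1)]` whose block columns are those of `v ⊗ I` and all
block columns of `X` but the last. -/
def ansatzBlock (X : Fin (m + 1) → Fin (m + 1) → Matrix ι ι R) (v : Fin (m + 1) → R) :
    Matrix (Fin (m + 1)) (Fin (m + 1)) (Matrix ι ι R) :=
  of fun i => (Fin.cons (v i • 1) fun j : Fin m => X i j.castSucc : Fin (m + 1) → Matrix ι ι R)

omit [Fintype ι] in
theorem ansatzBlock_zero (X : Fin (m + 1) → Fin (m + 1) → Matrix ι ι R) (v : Fin (m + 1) → R)
    (i : Fin (m + 1)) : ansatzBlock X v i 0 = v i • 1 := rfl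

omit [Fintype ι] in
theorem ansatzBlock_succ (X : Fin (m + 1) → Fin (m + 1) → Matrix ι ι R) (v : Fin (m + 1) → R)
    (i : Fin (m + 1)) (j : Fin m) : ansatzBlock X v i j.succ = X i j.castSucc := rfl

omit [Fintype ι] in
theorem ansatzBlock_map {S : Type*} [CommRing S] (f : R →+* S)
    (X : Fin (m + 1) → Fin (m + 1) → Matrix ι ι R) (v : Fin (m + 1) → R) :
    ansatzBlock (fun i j => (X i j).map f) (fun i => f (v i)) =
      (ansatzBlock X v).map fun M => M.map f := by
  ext i j a b
  refine Fin.cases ?_ (fun j => ?_) j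
  · simp [ansatzBlock_zero, Matrix.one_apply, apply_ite f]
  · rfl

omit [DecidableEq ι] in
theorem vecMul_comp_apply {k : ℕ} (B : Matrix (Fin k) (Fin k) (Matrix ι ι R))
    (u : Fin k × ι → R) (j : Fin k) :
    (fun b => (u ᵥ* comp _ _ _ _ R B) (j, b)) = ∑ i, (fun a => u (i, a)) ᵥ* B i j := by
  ext b
  simp [vecMul, dotProduct, Fintype.sum_prod_type, Finset.sum_apply]

/-- The one block column of X missing from `ansatzBlock` is v ⊗ P_{m+1}, which is killed along with
v ⊗ I. -/
theorem IsDoubleAnsatz.det_ansatzBlock_eq_zero_iff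
    {X Y : Fin (m + 1) → Fin (m + 1) → Matrix ι ι K} {v : Fin (m + 1) → K} {P : ℕ → Matrix ι ι K}
    (h : IsDoubleAnsatz X Y v P) :
    (comp _ _ _ _ K (ansatzBlock X v)).det = 0 ↔ leftKernel X v ≠ ⊥ := by
  have key : ∀ u : Fin (m + 1) × ι → K, u ᵥ* comp _ _ _ _ K (ansatzBlock X v) = 0 ↔
      (fun i a => u (i, a)) ∈ leftKernel X v := by
    intro u
    have h1 : u ᵥ* comp _ _ _ _ K (ansatzBlock X v) = 0 ↔
        ∀ j, ∑ i, (fun a => u (i, a)) ᵥ* ansatzBlock X v i j = 0 := by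
      simp only [← vecMul_comp_apply]
      exact ⟨fun h j => by rw [h]; rfl, fun h => funext fun x => congrFun (h x.1) x.2⟩
    rw [h1, Fin.forall_fin_succ]
    simp only [ansatzBlock_zero, ansatzBlock_succ, vecMul_smul, vecMul_one]
    refine ⟨fun ⟨h0, hs⟩ => ⟨fun j => ?_, h0⟩, fun h => ⟨h.2, fun j => h.1 _⟩⟩
    refine Fin.lastCases ?_ hs j
    simp only [h.right_last, vecMul_smul, ← smul_vecMul]
    rw [← sum_vecMul, h0, zero_vecMul]
  rw [← exists_vecMul_eq_zero_iff, Submodule.ne_bot_iff]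
  constructor
  · rintro ⟨u, hu, hu0⟩
    exact ⟨_, (key u).1 hu0, fun h0 => hu (funext fun x => congrFun (congrFun h0 x.1) x.2)⟩
  · rintro ⟨u, hu, hu0⟩
    exact ⟨fun x => u x.1 x.2, fun h0 => hu0 (by ext i a; exact congrFun h0 (i, a)),
      (key _).2 hu⟩

/-- The block matrix with identity block `I`, first block row `[I, H 0, H 1, …]` and `-I` on the
rest of the diagonal. -/
def hornerBlock (H : Fin m → Matrix ι ι R) :
    Matrix (Fin (m + 1)) (Fin (m + 1)) (Matrix ι ι R) :=
  of (Fin.cons (Fin.cons 1 H : Fin (m + 1) → Matrix ι ι R)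
    fun i : Fin m => (Fin.cons 0 fun j => if i = j then -1 else 0 : Fin (m + 1) → Matrix ι ι R))

omit [Fintype ι] in
theorem hornerBlock_zero_zero (H : Fin m → Matrix ι ι R) : hornerBlock H 0 0 = 1 := rfl

omit [Fintype ι] in
theorem hornerBlock_zero_succ (H : Fin m → Matrix ι ι R) (j : Fin m) :
    hornerBlock H 0 j.succ = H j := rfl

omit [Fintype ι] in
theorem hornerBlock_succ_zero (H : Fin m → Matrix ι ι R) (i : Fin m) :
    hornerBlock H i.succ 0 = 0 := rfl

omit [Fintype ι] in
theorem hornerBlock_succ_succ (H : Fin m → Matrix ι ι R) (i j : Fin m) :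
    hornerBlock H i.succ j.succ = if i = j then -1 else 0 := rfl

theorem mul_hornerBlock_zero (B : Matrix (Fin (m + 1)) (Fin (m + 1)) (Matrix ι ι R))
    (H : Fin m → Matrix ι ι R) (i : Fin (m + 1)) : (B * hornerBlock H) i 0 = B i 0 := by
  simp [Matrix.mul_apply, Fin.sum_univ_succ, hornerBlock_zero_zero, hornerBlock_succ_zero]

theorem mul_hornerBlock_succ (B : Matrix (Fin (m + 1)) (Fin (m + 1)) (Matrix ι ι R))
    (H : Fin m → Matrix ι ι R) (i : Fin (m + 1)) (j : Fin m) :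
    (B * hornerBlock H) i j.succ = B i 0 * H j - B i j.succ := by
  simp [Matrix.mul_apply, Fin.sum_univ_succ, hornerBlock_zero_succ, hornerBlock_succ_succ,
    sub_eq_add_neg]

/-- The matrix is an involution. -/
theorem isUnit_hornerBlock (H : Fin m → Matrix ι ι R) : IsUnit (hornerBlock H) := by
  have : hornerBlock H * hornerBlock H = 1 := by
    ext i j : 2
    refine Fin.cases ?_ (fun j => ?_) j
    · rw [mul_hornerBlock_zero]
      refine Fin.cases ?_ (fun i => ?_) i
      · simp [hornerBlock_zero_zero]
      · simp [hornerBlock_succ_zero]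
    · rw [mul_hornerBlock_succ]
      refine Fin.cases ?_ (fun i => ?_) i
      · simp [hornerBlock_zero_zero, hornerBlock_zero_succ,
          (Fin.succ_ne_zero j).symm]
      · by_cases hij : i = j <;>
          simp [hornerBlock_succ_zero, hornerBlock_succ_succ, Matrix.one_apply, hij]
  exact IsUnit.of_mul_eq_one _ this

/-- The bidiagonal matrix with ones on the diagonal and `-x` below it. -/
def shiftBlock (m : ℕ) (x : R) : Matrix (Fin (m + 1)) (Fin (m + 1)) R :=
  of fun i j => if i = j then 1 else if (i : ℕ) = j + 1 then -x else 0

theorem isUnit_shiftBlock (x : R) : IsUnit (shiftBlock m x) := by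
  rw [isUnit_iff_isUnit_det, det_of_isLowerTriangular]
  · simp [shiftBlock]
  · intro i j hij
    have hij : i < j := hij
    have h1 : (i : ℕ) ≠ j + 1 := by have := Fin.lt_def.1 hij; omega
    simp [shiftBlock, hij.ne, h1]

theorem mul_shiftBlock_castSucc (B : Matrix (Fin (m + 1)) (Fin (m + 1)) (Matrix ι ι R)) (x : R)
    (i : Fin (m + 1)) (j : Fin m) :
    (B * (shiftBlock m x).map (scalar ι)) i j.castSucc = B i j.castSucc - x • B i j.succ := by
  rw [Matrix.mul_apply]
  have : ∀ l : Fin (m + 1), B i l * ((shiftBlock m x).map (scalar ι)) l j.castSucc =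
      (if l = j.castSucc then B i l else 0) + if l = j.succ then -(x • B i l) else 0 := by
    intro l
    have hl : ((l : ℕ) = j + 1) ↔ l = j.succ := by simp [Fin.ext_iff]
    by_cases h1 : l = j.castSucc
    · subst h1
      have : j.castSucc ≠ j.succ := (Fin.castSucc_lt_succ).ne
      simp [shiftBlock, this]
    · by_cases h2 : l = j.succ
      · ext
        simp [shiftBlock, h2, (Fin.castSucc_lt_succ).ne', mul_diagonal, mul_comm x]
      · simp [shiftBlock, h1, h2, hl]
  simp only [this, Finset.sum_add_distrib, Finset.sum_ite_eq', Finset.mem_univ, if_true,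
    sub_eq_add_neg]

theorem mul_shiftBlock_last (B : Matrix (Fin (m + 1)) (Fin (m + 1)) (Matrix ι ι R)) (x : R)
    (i : Fin (m + 1)) :
    (B * (shiftBlock m x).map (scalar ι)) i (Fin.last m) = B i (Fin.last m) := by
  rw [Matrix.mul_apply, Finset.sum_eq_single_of_mem (Fin.last m) (Finset.mem_univ _)]
  · simp [shiftBlock]
  · intro l _ hl
    have : (l : ℕ) ≠ m + 1 := by omega
    simp [shiftBlock, hl, this]

end Factorization

/-! ### Linearization as invertibility of a constant matrix -/

section Linearization

variable {F : Type*} [Field F] {n m : ℕ}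

/-- The Horner recursion, which makes the terms in P telescope in the product with `shiftBlock`. -/
theorem iterate_divX_eq (p : F[X]) (j : ℕ) :
    divX^[j] p = C (p.coeff j) + X * divX^[j + 1] p := by
  have hc : ∀ j : ℕ, ∀ p : F[X], (divX^[j] p).coeff 0 = p.coeff j := by
    intro j
    induction j with
    | zero => intro p; rfl
    | succ j ih => intro p; rw [Function.iterate_succ_apply, ih, coeff_divX]
  rw [Function.iterate_succ_apply', ← hc, add_comm, X_mul_divX_add]

theorem iterate_divX_of_natDegree_le {p : F[X]} {j : ℕ} (hp : p.natDegree ≤ j) :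
    divX^[j] p = C (p.coeff j) := by
  induction j generalizing p with
  | zero => exact eq_C_of_natDegree_le_zero hp
  | succ j ih =>
    rw [Function.iterate_succ_apply, ih, coeff_divX]
    rw [natDegree_divX_eq_natDegree_tsub_one]
    omega

/-- A pencil in the double ansatz space is a constant matrix times `diag(P, I)`, up to unimodular
factors. -/
theorem IsDoubleAnsatz.pencil_eq {X Y : Fin (m + 1) → Fin (m + 1) → Matrix (Fin n) (Fin n) F}
    {v : Fin (m + 1) → F} {P : Matrix (Fin n) (Fin n) F[X]}
    (h : IsDoubleAnsatz X Y v fun i => P.map fun p => p.coeff i)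
    (hP : ∀ a b, (P a b).natDegree ≤ m + 1) :
    (of fun i j => (Polynomial.X : F[X]) • (X i j).map C + (Y i j).map C) =
      (ansatzBlock X v).map (fun M => M.map C) *
        hornerBlock (fun j : Fin m => P.map divX^[j + 1]) *
        diagonal (Fin.cons P 1) * (shiftBlock m Polynomial.X).map (scalar (Fin n)) := by
  set B := (ansatzBlock X v).map (fun M => M.map C) *
    hornerBlock (fun j : Fin m => P.map divX^[j + 1]) * diagonal (Fin.cons P 1) with hBdef
  -- Rewriting X_{i,j-1} as v_i P_j - Y_{i,j} gives every column the same shape, so that B_j -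
  -- λB_{j+1} collapses to λX_j + Y_j.
  have hB : ∀ i j, B i j = C (v i) • P.map divX^[j] + (Y i j).map C -
      (C (v i) • P.map fun p => C (p.coeff j)) := by
    intro i j
    rw [hBdef, mul_diagonal]
    refine Fin.cases ?_ (fun j => ?_) j
    · rw [mul_hornerBlock_zero, map_apply, ansatzBlock_zero, h.right_zero]
      ext a b
      simp [Matrix.mul_apply, Matrix.one_apply, apply_ite C]
    · rw [mul_hornerBlock_succ, map_apply, ansatzBlock_zero, map_apply, ansatzBlock_succ]
      ext a b
      have := congrFun (congrFun (h.right_succ i j) a) b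
      rw [Matrix.add_apply, ← eq_sub_iff_add_eq] at this
      simp [this, Matrix.mul_apply, Matrix.one_apply, apply_ite C, ite_mul]
      ring
  refine Matrix.ext fun i j => ?_
  refine Fin.lastCases ?_ (fun j => ?_) j
  · rw [mul_shiftBlock_last, hB, of_apply, h.right_last]
    refine Matrix.ext fun a b => ?_
    simp only [Matrix.add_apply, Matrix.sub_apply, Matrix.smul_apply, map_apply, smul_eq_mul,
      Fin.val_last, iterate_divX_eq (P a b) m, iterate_divX_of_natDegree_le (hP a b), C_mul]
    ring
  · rw [mul_shiftBlock_castSucc, hB, hB, of_apply]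
    refine Matrix.ext fun a b => ?_
    have := congrFun (congrFun (h.right_succ i j) a) b
    rw [Matrix.add_apply, ← eq_sub_iff_add_eq] at this
    simp only [Matrix.add_apply, Matrix.sub_apply, Matrix.smul_apply, map_apply, smul_eq_mul,
      Fin.val_castSucc, Fin.val_succ, iterate_divX_eq (P a b) j, this, C_mul, C_sub]
    ring

theorem isUnimodular_iff_isUnit {k : ℕ} (U : Matrix (Fin k × Fin n) (Fin k × Fin n) F[X]) :
    IsUnimodular U ↔ IsUnit U := by
  rw [isUnit_iff_isUnit_det, Polynomial.isUnit_iff]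
  exact ⟨fun ⟨c, hc, h⟩ => ⟨c, isUnit_iff_ne_zero.2 hc, h.symm⟩,
    fun ⟨c, hc, h⟩ => ⟨c, hc.ne_zero, h.symm⟩⟩

theorem isLinearization_mul_mul {k : ℕ} {P : Matrix (Fin n) (Fin n) F[X]}
    {U V L : Matrix (Fin k × Fin n) (Fin k × Fin n) F[X]} (hU : IsUnit U) (hV : IsUnit V)
    (h : IsLinearization L P) : IsLinearization (U * L * V) P := by
  obtain ⟨U', V', hU', hV', rfl⟩ := h
  rw [isUnimodular_iff_isUnit] at hU' hV'
  exact ⟨U * U', V' * V, (isUnimodular_iff_isUnit _).2 (hU.mul hU'),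
    (isUnimodular_iff_isUnit _).2 (hV'.mul hV), by simp only [Matrix.mul_assoc]⟩

theorem isLinearization_mul_mul_iff {k : ℕ} {P : Matrix (Fin n) (Fin n) F[X]}
    {U V L : Matrix (Fin k × Fin n) (Fin k × Fin n) F[X]} (hU : IsUnit U) (hV : IsUnit V) :
    IsLinearization (U * L * V) P ↔ IsLinearization L P := by
  refine ⟨fun h => ?_, isLinearization_mul_mul hU hV⟩
  obtain ⟨U, rfl⟩ := hU
  obtain ⟨V, rfl⟩ := hV
  simpa [Matrix.mul_assoc] using isLinearization_mul_mul U⁻¹.isUnit V⁻¹.isUnit h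

theorem comp_diagonal_cons (P : Matrix (Fin n) (Fin n) F[X]) :
    comp _ _ _ _ F[X] (diagonal (Fin.cons P 1 : Fin (m + 1) → Matrix (Fin n) (Fin n) F[X])) =
      diagOne (m + 1) P := by
  ext ⟨i, a⟩ ⟨j, b⟩
  refine Fin.cases ?_ (fun i => ?_) i <;> refine Fin.cases ?_ (fun j => ?_) j
  · simp [diagOne, blockDiagonal_apply]
  · simp [diagOne, blockDiagonal_apply, (Fin.succ_ne_zero j).symm]
  · simp [diagOne, blockDiagonal_apply]
  · simp [diagOne, blockDiagonal_apply, diagonal_apply, apply_ite]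
    split_ifs <;> simp

theorem det_diagOne_ne_zero {P : Matrix (Fin n) (Fin n) F[X]} (hP : P.det ≠ 0) (k : ℕ) :
    (diagOne k P).det ≠ 0 := by
  unfold diagOne
  have : ∀ M : Matrix (Fin n × Fin k) (Fin n × Fin k) F[X],
      (M.submatrix Prod.swap Prod.swap).det = M.det := fun M =>
    det_submatrix_equiv_self (Equiv.prodComm (Fin k) (Fin n)) M
  rw [this, det_blockDiagonal, Finset.prod_ne_zero_iff]
  intro i _
  split_ifs
  · exact hP
  · simp

theorem IsDoubleAnsatz.isLinearization_iff
    {X Y : Fin (m + 1) → Fin (m + 1) → Matrix (Fin n) (Fin n) F}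
    {v : Fin (m + 1) → F} {P : Matrix (Fin n) (Fin n) F[X]}
    (h : IsDoubleAnsatz X Y v fun i => P.map fun p => p.coeff i)
    (hP : ∀ a b, (P a b).natDegree ≤ m + 1) (hreg : IsRegular P) :
    IsLinearization (pencil (comp _ _ _ _ F (of X)) (comp _ _ _ _ F (of Y))) P ↔
      (comp _ _ _ _ F (ansatzBlock X v)).det ≠ 0 := by
  have hL : pencil (comp _ _ _ _ F (of X)) (comp _ _ _ _ F (of Y)) =
      (comp _ _ _ _ F (ansatzBlock X v)).map C *
        comp _ _ _ _ F[X] (hornerBlock fun j : Fin m => P.map divX^[j + 1]) *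
        diagOne (m + 1) P *
        comp _ _ _ _ F[X] ((shiftBlock m Polynomial.X).map (scalar (Fin n))) := by
    have := congrArg (compRingEquiv (Fin (m + 1)) (Fin n) F[X]) (h.pencil_eq hP)
    simp only [map_mul, compRingEquiv_apply] at this
    rw [comp_diagonal_cons] at this
    exact this
  have hH : IsUnit (comp _ _ _ _ F[X] (hornerBlock fun j : Fin m => P.map divX^[j + 1])) :=
    (isUnit_comp_iff _ _ _).2 (isUnit_hornerBlock _)
  have hV : IsUnit
      (comp _ _ _ _ F[X] ((shiftBlock m (Polynomial.X : F[X])).map (scalar (Fin n)))) :=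
    (isUnit_comp_iff _ _ _).2 ((isUnit_shiftBlock _).map (scalar (Fin n)).mapMatrix)
  have hdetW : ((comp _ _ _ _ F (ansatzBlock X v)).map C).det =
      C (comp _ _ _ _ F (ansatzBlock X v)).det := by
    rw [RingHom.map_det]; rfl
  constructor
  · rintro ⟨U, V, hU, hV, hUV⟩ h0
    rw [isUnimodular_iff_isUnit, isUnit_iff_isUnit_det] at hU hV
    have h1 := congrArg det (hL.symm.trans hUV)
    simp only [det_mul, hdetW, h0, C_0, zero_mul] at h1
    exact mul_ne_zero (mul_ne_zero hU.ne_zero (det_diagOne_ne_zero hreg _)) hV.ne_zero h1.symm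
  · intro hd
    refine ⟨_, _, (isUnimodular_iff_isUnit _).2 (IsUnit.mul ?_ hH),
      (isUnimodular_iff_isUnit _).2 hV, hL⟩
    rw [isUnit_iff_isUnit_det, hdetW]
    exact isUnit_C.2 (isUnit_iff_ne_zero.2 hd)

end Linearization

/-! ### Common eigenvalues, finite and infinite -/

section Eigenvalues

variable {F : Type*} [Field F] {n m : ℕ}

theorem aeval_eq_sum_coeff {K : Type*} [Field K] [Algebra F K]
    {P : Matrix (Fin n) (Fin n) F[X]} (hP : ∀ a b, (P a b).natDegree ≤ m + 1) (μ : K) :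
    P.map (fun p => aeval μ p) = ∑ i ∈ Finset.range (m + 2),
      μ ^ i • (P.map fun p => p.coeff i).map (algebraMap F K) := by
  ext a b
  rw [map_apply, aeval_eq_sum_range' (Nat.lt_succ_of_le (hP a b)), Matrix.sum_apply]
  refine Finset.sum_congr rfl fun i _ => ?_
  simp [Algebra.smul_def, mul_comm]

/-- The constant block matrix of a double ansatz pencil is singular exactly when the ansatz
polynomial and `P` have a common eigenvalue. -/
theorem IsDoubleAnsatz.det_eq_zero_iff_exists_isEigenvalue [NeZero n]
    {X Y : Fin (m + 1) → Fin (m + 1) → Matrix (Fin n) (Fin n) F}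
    {v : Fin (m + 1) → F} {P : Matrix (Fin n) (Fin n) F[X]}
    (h : IsDoubleAnsatz X Y v fun i => P.map fun p => p.coeff i)
    (hP : ∀ a b, (P a b).natDegree ≤ m + 1) {q : F[X]}
    (hq : q = ∑ i, C (v i) * Polynomial.X ^ (i : ℕ)) :
    (comp _ _ _ _ F (ansatzBlock X v)).det = 0 ↔
      ∃ μ : OnePoint (AlgebraicClosure F),
        IsEigenvalue m (q • (1 : Matrix (Fin n) (Fin n) F[X])) μ ∧ IsEigenvalue (m + 1) P μ := by
  -- Only additivity of f is assumed, so this covers both evaluation at μ and extraction of the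
  -- coefficient of λ^m.
  have hdet : ∀ {S : Type _} [Field S] (f : F[X] →+ S),
      ((q • (1 : Matrix (Fin n) (Fin n) F[X])).map f).det = 0 ↔ f q = 0 := by
    intro S _ f
    have : (q • (1 : Matrix (Fin n) (Fin n) F[X])).map f = diagonal fun _ => f q := by
      ext a b
      by_cases hab : a = b <;> simp [hab]
    rw [this, det_diagonal]
    simp [NeZero.ne n]
  let ι := algebraMap F (AlgebraicClosure F)
  have hK := h.map ι
  have hW : (comp _ _ _ _ F (ansatzBlock X v)).det = 0 ↔
      leftKernel (fun i j => (X i j).map ι) (fun i => ι (v i)) ≠ ⊥ := by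
    rw [← hK.det_ansatzBlock_eq_zero_iff, ansatzBlock_map, ← map_eq_zero ι, RingHom.map_det]
    rfl
  have hroot : ∀ μ : AlgebraicClosure F,
      IsEigenvalue m (q • (1 : Matrix (Fin n) (Fin n) F[X])) (OnePoint.some μ) ↔
        ∑ i, ι (v i) * μ ^ (i : ℕ) = 0 := by
    intro μ
    refine (hdet (aeval μ : F[X] →ₐ[F] AlgebraicClosure F).toRingHom.toAddMonoidHom).trans ?_
    simp [hq, ι]
  have hinf : IsEigenvalue m (q • (1 : Matrix (Fin n) (Fin n) F[X])) OnePoint.infty ↔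
      ι (v (Fin.last m)) = 0 := by
    refine (hdet (lcoeff F m).toAddMonoidHom).trans ?_
    rw [map_eq_zero ι]
    have : q.coeff m = v (Fin.last m) := by
      rw [hq, finsetSum_coeff, Finset.sum_eq_single_of_mem (Fin.last m) (Finset.mem_univ _)]
      · simp
      · intro i _ hi
        have : m ≠ (i : ℕ) := by
          intro h; exact hi (Fin.ext h.symm)
        simp [coeff_X_pow, this]
    change q.coeff m = 0 ↔ _
    rw [this]
  have hPinf : IsEigenvalue (m + 1) P OnePoint.infty ↔
      ((P.map fun p => p.coeff (m + 1)).map ι).det = 0 := by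
    have h1 := RingHom.map_det ι (P.map fun p => p.coeff (m + 1))
    rw [RingHom.mapMatrix_apply] at h1
    rw [← h1, map_eq_zero]
    rfl
  have hPfin : ∀ μ : AlgebraicClosure F, IsEigenvalue (m + 1) P (OnePoint.some μ) ↔
      (∑ i ∈ Finset.range (m + 2), μ ^ i • (P.map fun p => p.coeff i).map ι).det = 0 := by
    intro μ
    rw [← aeval_eq_sum_coeff hP]
    rfl
  rw [hW]
  constructor
  · intro hne
    rcases hK.exists_common_eigenvalue hne with ⟨h1, h2⟩ | ⟨μ, h1, h2⟩
    · exact ⟨OnePoint.infty, hinf.2 h1, hPinf.2 h2⟩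
    · exact ⟨OnePoint.some μ, (hroot μ).2 h1, (hPfin μ).2 h2⟩
  · rintro ⟨μ | μ, h1, h2⟩
    · exact hK.leftKernel_ne_bot_of_infty (hinf.1 h1) (hPinf.1 h2)
    · exact hK.leftKernel_ne_bot_of_root ((hroot μ).1 h1) ((hPfin μ).1 h2)

end Eigenvalues

/-! ### Reduction to the monomial basis -/

section ChangeOfBasis

variable {F : Type*} [Field F] {n k m : ℕ} {φ : Fin (k + 1) → F[X]}

theorem IsPolynomialBasis.natDegree_le (hφ : IsPolynomialBasis φ) (i : Fin (k + 1)) :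
    (φ i).natDegree ≤ k := by
  have : φ i ∈ degreeLT F (k + 1) := by
    rw [← hφ.span_eq]
    exact Submodule.subset_span ⟨i, rfl⟩
  rw [mem_degreeLT] at this
  exact natDegree_le_iff_degree_le.2 (Order.le_of_lt_succ (by exact_mod_cast this))

theorem IsPolynomialBasis.natDegree_ofCoeffs_le (hφ : IsPolynomialBasis φ)
    (A : Fin (k + 1) → Matrix (Fin n) (Fin n) F) (a b : Fin n) :
    (ofCoeffs φ A a b).natDegree ≤ k := by
  rw [ofCoeffs, Matrix.sum_apply]
  refine natDegree_sum_le_of_forall_le _ _ fun i _ => ?_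
  rw [Matrix.smul_apply, map_apply, smul_eq_mul]
  exact (natDegree_mul_C_le _ _).trans (hφ.natDegree_le i)

/-- The matrix of the coefficients of `Λ` in the monomial basis `1, λ, …, λ ^ (k - 1)`. -/
def coeffMatrix (φ : Fin (k + 1) → F[X]) : Matrix (Fin k) (Fin k) F :=
  of fun i j => (basisVec φ i).coeff j

/-- The vector `[1, λ, …, λ ^ (k - 1)]`. -/
noncomputable def monomialVec (F : Type*) [Field F] (k : ℕ) : Fin k → F[X] :=
  fun j => Polynomial.X ^ (j : ℕ)

theorem IsPolynomialBasis.basisVec_eq (hφ : IsPolynomialBasis φ) (i : Fin k) :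
    basisVec φ i = ∑ j, C (coeffMatrix φ i j) * Polynomial.X ^ (j : ℕ) := by
  have h1 : basisVec φ i ∈ degreeLT F k := by
    rw [← hφ.span_init_eq]
    exact Submodule.subset_span ⟨i.rev, rfl⟩
  rw [mem_degreeLT] at h1
  by_cases h0 : basisVec φ i = 0
  · simp [coeffMatrix, h0]
  · have h2 := (natDegree_lt_iff_degree_lt h0).2 h1
    conv_lhs => rw [as_sum_range_C_mul_X_pow' _ h2, Finset.sum_range]
    rfl

theorem IsPolynomialBasis.isUnit_coeffMatrix (hφ : IsPolynomialBasis φ) :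
    IsUnit (coeffMatrix φ) := by
  rw [← linearIndependent_rows_iff_isUnit, Fintype.linearIndependent_iff]
  intro g hg
  have hli : LinearIndependent F (basisVec φ) := hφ.linearIndependent.comp _
    ((Fin.castSucc_injective k).comp Fin.rev_injective)
  refine Fintype.linearIndependent_iff.1 hli g ?_
  simp only [hφ.basisVec_eq, Finset.smul_sum]
  rw [Finset.sum_comm]
  refine Finset.sum_eq_zero fun j _ => ?_
  have h1 : ∑ i, g i * coeffMatrix φ i j = 0 := by
    simpa [Finset.sum_apply] using congrFun hg j
  have h2 : ∀ i, g i • (C (coeffMatrix φ i j) * (Polynomial.X : F[X]) ^ (j : ℕ)) =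
      C (g i * coeffMatrix φ i j) * Polynomial.X ^ (j : ℕ) := fun i => by
    rw [smul_eq_C_mul, C_mul, mul_assoc]
  simp only [h2, ← Finset.sum_mul, ← map_sum, h1, C_0, zero_mul]

theorem IsPolynomialBasis.replicateCol_basisVec (hφ : IsPolynomialBasis φ) :
    replicateCol Unit (basisVec φ) =
      (coeffMatrix φ).map C * replicateCol Unit (monomialVec F k) := by
  ext i : 2
  rw [replicateCol_apply, hφ.basisVec_eq, Matrix.mul_apply]
  rfl

theorem IsPolynomialBasis.replicateRow_basisVec (hφ : IsPolynomialBasis φ) :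
    replicateRow Unit (basisVec φ) =
      replicateRow Unit (monomialVec F k) * ((coeffMatrix φ).map C)ᵀ := by
  rw [← transpose_replicateCol, hφ.replicateCol_basisVec, transpose_mul, transpose_replicateCol]

theorem IsPolynomialBasis.ansatzPoly_eq (hφ : IsPolynomialBasis φ) (v : Fin k → F) :
    ansatzPoly φ v = ∑ j, C ((v ᵥ* coeffMatrix φ) j) * Polynomial.X ^ (j : ℕ) := by
  simp only [ansatzPoly, hφ.basisVec_eq, Finset.mul_sum]
  rw [Finset.sum_comm]
  refine Finset.sum_congr rfl fun j _ => ?_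
  simp only [vecMul, dotProduct, map_sum, C_mul, Finset.sum_mul, mul_assoc]

theorem pencil_map_mul_mul (G X Y : Matrix (Fin k × Fin n) (Fin k × Fin n) F) :
    pencil (Gᵀ * X * G) (Gᵀ * Y * G) = (G.map C)ᵀ * pencil X Y * G.map C := by
  simp only [pencil, Matrix.map_mul, Matrix.mul_add, Matrix.add_mul, Matrix.mul_smul,
    Matrix.smul_mul, transpose_map]

variable {P : Matrix (Fin n) (Fin n) F[X]} {L : Matrix (Fin k × Fin n) (Fin k × Fin n) F[X]}

theorem map_kronecker_one (N : Matrix (Fin k) (Fin k) F) :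
    (N ⊗ₖ (1 : Matrix (Fin n) (Fin n) F)).map C =
      N.map C ⊗ₖ (1 : Matrix (Fin n) (Fin n) F[X]) := by
  ext ⟨i, a⟩ ⟨j, b⟩
  simp [kroneckerMap_apply, Matrix.one_apply, apply_ite C]

/-- The right factor N ⊗ I turns monomials into Λ; its transpose on the left is what the left ansatz
needs, and here it only changes v to Nᵀv. -/
theorem IsPolynomialBasis.hasAnsatz_monomial (hφ : IsPolynomialBasis φ) {v : Fin k → F}
    (h : HasAnsatz φ P L v) :
    ((coeffMatrix φ).map C ⊗ₖ (1 : Matrix (Fin n) (Fin n) F[X]))ᵀ * L *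
        ((coeffMatrix φ).map C ⊗ₖ (1 : Matrix (Fin n) (Fin n) F[X])) *
        (replicateCol Unit (monomialVec F k) ⊗ₖ (1 : Matrix (Fin n) (Fin n) F[X])) =
      replicateCol Unit (fun i => C ((v ᵥ* coeffMatrix φ) i)) ⊗ₖ P := by
  rw [Matrix.mul_assoc, ← mul_kronecker_mul, ← hφ.replicateCol_basisVec, Matrix.one_mul,
    Matrix.mul_assoc, h, ← kroneckerMap_transpose, transpose_one, ← mul_kronecker_mul,
    Matrix.one_mul]
  congr 1
  ext i : 2
  simp [Matrix.mul_apply, vecMul, dotProduct, mul_comm]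

theorem IsPolynomialBasis.hasLeftAnsatz_monomial (hφ : IsPolynomialBasis φ) {w : Fin k → F}
    (h : HasLeftAnsatz φ P L w) :
    (replicateRow Unit (monomialVec F k) ⊗ₖ (1 : Matrix (Fin n) (Fin n) F[X])) *
        (((coeffMatrix φ).map C ⊗ₖ (1 : Matrix (Fin n) (Fin n) F[X]))ᵀ * L *
        ((coeffMatrix φ).map C ⊗ₖ (1 : Matrix (Fin n) (Fin n) F[X]))) =
      replicateRow Unit (fun i => C ((w ᵥ* coeffMatrix φ) i)) ⊗ₖ P := by
  rw [← Matrix.mul_assoc, ← Matrix.mul_assoc, ← kroneckerMap_transpose, transpose_one,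
    ← mul_kronecker_mul, ← hφ.replicateRow_basisVec, Matrix.one_mul, h, ← mul_kronecker_mul,
    Matrix.mul_one]
  congr 1
  ext i j : 2
  simp [Matrix.mul_apply, vecMul, dotProduct]

theorem coeff_sum_pencil (x y : Fin k → F) (d : ℕ) :
    (∑ j, (Polynomial.X * C (x j) + C (y j)) * Polynomial.X ^ (j : ℕ)).coeff d =
      ∑ j : Fin k, ((if d = j + 1 then x j else 0) + if d = j then y j else 0) := by
  rw [finsetSum_coeff]
  refine Finset.sum_congr rfl fun j _ => ?_
  have : (Polynomial.X * C (x j) + C (y j)) * Polynomial.X ^ (j : ℕ) =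
      C (x j) * Polynomial.X ^ ((j : ℕ) + 1) + C (y j) * Polynomial.X ^ (j : ℕ) := by ring
  rw [this, coeff_add, coeff_C_mul_X_pow, coeff_C_mul_X_pow]

theorem coeff_relations_of_sum_pencil_eq {x y : Fin (m + 1) → F} {p : F[X]}
    (h : ∑ j, (Polynomial.X * C (x j) + C (y j)) * Polynomial.X ^ (j : ℕ) = p) :
    y 0 = p.coeff 0 ∧ (∀ j : Fin m, x j.castSucc + y j.succ = p.coeff (j + 1)) ∧
      x (Fin.last m) = p.coeff (m + 1) := by
  subst h
  simp only [coeff_sum_pencil, Finset.sum_add_distrib]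
  have hx : ∀ j : Fin (m + 1),
      (∑ i : Fin (m + 1), if (j : ℕ) + 1 = i + 1 then x i else 0) = x j := by
    intro j
    simp [← Fin.ext_iff]
  have hy : ∀ j : Fin (m + 1), (∑ i : Fin (m + 1), if (j : ℕ) = i then y i else 0) = y j := by
    intro j
    simp [← Fin.ext_iff]
  refine ⟨?_, fun j => ?_, ?_⟩
  · rw [Finset.sum_eq_zero fun i _ => if_neg (by omega), zero_add]
    exact (hy 0).symm
  · have h1 := hx j.castSucc
    have h2 := hy j.succ
    rw [Fin.val_castSucc] at h1
    rw [Fin.val_succ] at h2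
    rw [h1, h2]
  · rw [Finset.sum_eq_zero (f := fun i : Fin (m + 1) => if m + 1 = (i : ℕ) then y i else 0)
      fun i _ => if_neg (by omega), add_zero]
    exact (hx (Fin.last m)).symm

theorem isDoubleAnsatz_of_monomial {X Y : Matrix (Fin (m + 1) × Fin n) (Fin (m + 1) × Fin n) F}
    {v : Fin (m + 1) → F}
    (hr : pencil X Y *
        (replicateCol Unit (monomialVec F (m + 1)) ⊗ₖ (1 : Matrix (Fin n) (Fin n) F[X])) =
      replicateCol Unit (fun i => C (v i)) ⊗ₖ P)
    (hl : (replicateRow Unit (monomialVec F (m + 1)) ⊗ₖ (1 : Matrix (Fin n) (Fin n) F[X])) *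
        pencil X Y = replicateRow Unit (fun i => C (v i)) ⊗ₖ P) :
    IsDoubleAnsatz (fun i j => of fun a b => X (i, a) (j, b))
      (fun i j => of fun a b => Y (i, a) (j, b)) v (fun i => P.map fun p => p.coeff i) := by
  have hr' : ∀ i a b, ∑ j, (Polynomial.X * C (X (i, a) (j, b)) + C (Y (i, a) (j, b))) *
      Polynomial.X ^ (j : ℕ) = C (v i) * P a b := by
    intro i a b
    have := congrFun (congrFun hr (i, a)) ((), b)
    simpa [Matrix.mul_apply, Fintype.sum_prod_type, kroneckerMap_apply, pencil, Matrix.one_apply,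
      monomialVec] using this
  have hl' : ∀ j a b, ∑ i, (Polynomial.X * C (X (i, a) (j, b)) + C (Y (i, a) (j, b))) *
      Polynomial.X ^ (i : ℕ) = C (v j) * P a b := by
    intro j a b
    have := congrFun (congrFun hl ((), a)) (j, b)
    simp only [mul_comm _ (Polynomial.X ^ _)]
    simpa [Matrix.mul_apply, Fintype.sum_prod_type, kroneckerMap_apply, pencil, Matrix.one_apply,
      monomialVec] using this
  constructor
  · intro i; ext a b
    simpa using (coeff_relations_of_sum_pencil_eq (hr' i a b)).1
  · intro i j; ext a b
    simpa using (coeff_relations_of_sum_pencil_eq (hr' i a b)).2.1 j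
  · intro i; ext a b
    simpa using (coeff_relations_of_sum_pencil_eq (hr' i a b)).2.2
  · intro j; ext a b
    simpa using (coeff_relations_of_sum_pencil_eq (hl' j a b)).1
  · intro i j; ext a b
    simpa using (coeff_relations_of_sum_pencil_eq (hl' j a b)).2.1 i
  · intro j; ext a b
    simpa using (coeff_relations_of_sum_pencil_eq (hl' j a b)).2.2

/-- For a nonzero `P`, the right and left ansatz vectors of a pencil in the double ansatz space
agree. -/
theorem ansatz_eq_of_monomial (hP : P ≠ 0) {v w : Fin k → F}
    (hr : L * (replicateCol Unit (monomialVec F k) ⊗ₖ (1 : Matrix (Fin n) (Fin n) F[X])) =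
      replicateCol Unit (fun i => C (v i)) ⊗ₖ P)
    (hl : (replicateRow Unit (monomialVec F k) ⊗ₖ (1 : Matrix (Fin n) (Fin n) F[X])) * L =
      replicateRow Unit (fun i => C (w i)) ⊗ₖ P) : w = v := by
  -- Multiplying L by the monomial vector on both sides gives w(λ)P = v(λ)P; a nonzero entry of P
  -- cancels.
  have h1 := congrArg (fun M => M *
    (replicateCol Unit (monomialVec F k) ⊗ₖ (1 : Matrix (Fin n) (Fin n) F[X]))) hl
  simp only [Matrix.mul_assoc, hr, ← mul_kronecker_mul, Matrix.one_mul, Matrix.mul_one] at h1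
  have hne : ∃ a b, P a b ≠ 0 := by
    by_contra! h
    exact hP (by ext1 a b; exact h a b)
  obtain ⟨a, b, hab⟩ := hne
  have h2 := congrFun (congrFun h1 ((), a)) ((), b)
  simp only [kroneckerMap_apply] at h2
  have h3 := mul_right_cancel₀ hab h2
  simp only [Matrix.mul_apply, replicateRow_apply, replicateCol_apply, monomialVec] at h3
  ext j
  have h4 := congrArg (fun p : F[X] => p.coeff j) h3
  simpa [finsetSum_coeff, coeff_X_pow_mul', coeff_C_mul, coeff_X_pow, coeff_C, ← Fin.ext_iff]
    using h4.symm

end ChangeOfBasis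

end MatPoly

/-! ### The exclusion theorem -/

theorem theorem4p1 {F : Type*} [Field F] {n k : ℕ}
    (φ : Fin (k + 1) → F[X]) (hφ : MatPoly.IsPolynomialBasis φ)
    (A : Fin (k + 1) → Matrix (Fin n) (Fin n) F) (hA : A (Fin.last k) ≠ 0)
    (P : Matrix (Fin n) (Fin n) F[X]) (hP : P = MatPoly.ofCoeffs φ A)
    (hreg : MatPoly.IsRegular P)
    (L : Matrix (Fin k × Fin n) (Fin k × Fin n) F[X]) (hL : L ∈ MatPoly.DL φ P)
    (v : Fin k → F) (hv : MatPoly.HasAnsatz φ P L v) (hv0 : MatPoly.ansatzPoly φ v ≠ 0) :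
    MatPoly.IsLinearization L P ↔
      ¬ ∃ μ : OnePoint (AlgebraicClosure F),
          MatPoly.IsEigenvalue (k - 1)
            (MatPoly.ansatzPoly φ v • (1 : Matrix (Fin n) (Fin n) F[X])) μ ∧
          MatPoly.IsEigenvalue k P μ := by
  -- Needed because det(qI) = q^n detects the zeros of q only for n ≥ 1.
  have hn : NeZero n := ⟨by
    rintro rfl
    exact hA (Subsingleton.elim _ _)⟩
  obtain _ | m := k
  · exact absurd (by simp [MatPoly.ansatzPoly]) hv0
  have hP0 : P ≠ 0 := by
    rintro rfl
    exact hreg det_zero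
  have hdeg : ∀ a b, (P a b).natDegree ≤ m + 1 := by
    subst hP
    exact hφ.natDegree_ofCoeffs_le A
  obtain ⟨⟨⟨X, Y, rfl⟩, -⟩, -, w, hw⟩ := hL
  set N := MatPoly.coeffMatrix φ with hN
  let G : Matrix (Fin (m + 1) × Fin n) (Fin (m + 1) × Fin n) F := N ⊗ₖ 1
  have hr := hφ.hasAnsatz_monomial hv
  have hl := hφ.hasLeftAnsatz_monomial hw
  rw [MatPoly.ansatz_eq_of_monomial hP0 hr hl] at hl
  rw [← MatPoly.map_kronecker_one, ← MatPoly.pencil_map_mul_mul] at hr hl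
  have hG : IsUnit (G.map C) := by
    rw [MatPoly.map_kronecker_one, isUnit_iff_isUnit_det, det_kronecker, det_one, one_pow, mul_one]
    exact ((isUnit_iff_isUnit_det _).1 (hφ.isUnit_coeffMatrix.map C.mapMatrix)).pow _
  have hB := MatPoly.isDoubleAnsatz_of_monomial hr hl
  rw [← MatPoly.isLinearization_mul_mul_iff (isUnit_transpose _ |>.2 hG) hG,
    ← MatPoly.pencil_map_mul_mul]
  exact (hB.isLinearization_iff hdeg hreg).trans
    (hB.det_eq_zero_iff_exists_isEigenvalue hdeg (hφ.ansatzPoly_eq v)).not
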